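/- Let $n\ge 0$ be the spatial dimension. All objects are taken at a point of an $(n+1)$-dimensional spacetime, in a chart $(t,x^1,\dots,x^n)$ adapted to a foliation by the slices $t=\mathrm{const}$; metrics are symmetric real $(n+1)\times(n+1)$ matrices. A metric $g$ is Lorentzian if $g=E^{\mathsf T}\eta E$ with $E$ invertible and $\eta=\mathrm{diag}(-1,1,\dots,1)$, and the slice is spacelike for $g$ if the spatial block $(g_{ij})$ is positive definite. A real principal square root $A^{1/2}$ of a real matrix $A$ is a real matrix $X$ with $X^2=A$ all of whose complex eigenvalues have positive real part. For $\xi\in\mathbb R^n$ put $\Xi[\xi]=\begin{pmatrix}1&0\\ \xi&I\end{pmatrix}$. Given parameters $p,q\in\mathbb R^n$ (boost vector, mean shift), lapses $N,M>0$ and invertible $n\times n$ matrices $e,\bar m$ (spatial vielbeins), define $$\lambda=(1+p^{\mathsf T}p)^{1/2},\quad \hat\Lambda=(I+pp^{\mathsf T})^{1/2},\quad \bar R=\bar m^{-1,\mathsf T}e^{\mathsf T}\hat\Lambda,\quad \hat R=(\bar R^{\mathsf T}\bar R)^{1/2}\bar R^{-1},\quad m=\hat R\,\bar m,$$ $$\gamma=e^{\mathsf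 T}e,\quad \varphi=\bar m^{\mathsf T}\bar m,\quad \chi=e^{\mathsf T}\hat\Lambda m,\quad H=(NM\lambda^{-1})^{1/2},\quad \vec N=q+N e^{-1}p\lambda^{-1},\quad \vec M=q-M m^{-1}p\lambda^{-1},$$ $$g=\Xi[\vec N]^{\mathsf T}\begin{pmatrix}-N^2&0\\0&\gamma\end{pmatrix}\Xi[\vec N],\quad f=\Xi[\vec M]^{\mathsf T}\begin{pmatrix}-M^2&0\\0&\varphi\end{pmatrix}\Xi[\vec M],\quad h=\Xi[q]^{\mathsf T}\begin{pmatrix}-H^2&0\\0&\chi\end{pmatrix}\Xi[q],\quad S=g^{-1}h .$$ (Validity) For all such parameters, $\hat R$ is orthogonal, $g$, $f$ and $h$ are Lorentzian metrics for which the slice is spacelike, $S$ is a real principal square root of $g^{-1}f$, $S=h^{-1}f$, and $h=g(g^{-1}f)^{1/2}$ is the geometric mean of $g$ and $f$. (Exhaustiveness) Conversely, let $g,f$ be Lorentzian metrics for both of which the slice is spacelike, and let $S$ be a real principal square root of $g^{-1}f$. Then there are parameters as above that produce exactly $g$, $f$ and $S$. Moreover, $e$ and $\bar m$ can be taken to be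 any prescribed matrices with $e^{\mathsf T}e=(g_{ij})$ and $\bar m^{\mathsf T}\bar m=(f_{ij})$. -/

import Mathlib

open scoped Matrix

noncomputable section

namespace GeomMeanParam

/-- Index set of spacetime components in a chart `(t, x¹, …, xⁿ)` adapted to the foliation:
`Sum.inl ()` is the time direction, `Sum.inr i` are the directions tangent to the slices. -/
abbrev STIdx (n : ℕ) : Type := Unit ⊕ Fin n

/-- Spacetime matrices (components of metrics and operators at a point). -/
abbrev STMat (n : ℕ) : Type := Matrix (STIdx n) (STIdx n) ℝ

/-- Spatial matrices. -/
abbrev SpMat (n : ℕ) : Type := Matrix (Fin n) (Fin n) ℝ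

/-- `X` is the real principal square root of the real matrix `A`: `X² = A` and every complex
eigenvalue of `X` lies in the open right half plane. -/
def IsPrincipalSqrt {ι : Type*} [Fintype ι] [DecidableEq ι] (A X : Matrix ι ι ℝ) : Prop :=
  X * X = A ∧ ∀ μ ∈ spectrum ℂ (X.map (algebraMap ℝ ℂ)), 0 < μ.re

open Classical in
/-- The principal square root `A^{1/2}` (with the value `0` if there is none). -/
def principalSqrt {ι : Type*} [Fintype ι] [DecidableEq ι] (A : Matrix ι ι ℝ) : Matrix ι ι ℝ :=
  if h : ∃ X, IsPrincipalSqrt A X then h.choose else 0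

/-- The geometric mean `g # f = g (g⁻¹ f)^{1/2}`. -/
def geomMean {ι : Type*} [Fintype ι] [DecidableEq ι] (g f : Matrix ι ι ℝ) : Matrix ι ι ℝ :=
  g * principalSqrt (g⁻¹ * f)

/-- The Minkowski metric `η = diag(-1, 1, …, 1)`. -/
def minkowski (n : ℕ) : STMat n := Matrix.fromBlocks (-1) 0 0 1

/-- A Lorentzian metric at a point: a symmetric matrix of signature `(-,+,…,+)`, that is,
`g = Eᵀ η E` for some invertible `E` (a vielbein). -/
def IsLorentzian {n : ℕ} (g : STMat n) : Prop :=
  ∃ E : STMat n, IsUnit E.det ∧ g = Eᵀ * minkowski n * E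

/-- The slice of the foliation is spacelike with respect to `g`: the metric induced on the
vectors tangent to the slice is positive definite. -/
def SpacelikeSlice {n : ℕ} (g : STMat n) : Prop := g.toBlocks₂₂.PosDef

/-- The shear operator `Ξ[ξ]`; as a coframe, the Cauchy adapted frame with shift `ξ`. -/
def shear {n : ℕ} (ξ : Fin n → ℝ) : STMat n :=
  Matrix.fromBlocks 1 0 (Matrix.replicateCol Unit ξ) 1

/-- The metric with lapse `N`, shift `ξ` and spatial metric `γ`:
`Ξ[ξ]ᵀ diag(-N², γ) Ξ[ξ]`. -/
def admMetric {n : ℕ} (N : ℝ) (ξ : Fin n → ℝ) (γ : SpMat n) : STMat n :=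
  (shear ξ)ᵀ * Matrix.fromBlocks ((-N ^ 2) • (1 : Matrix Unit Unit ℝ)) 0 0 γ * shear ξ

/-- The free data: a boost vector `p`, the shift `q` of the mean metric, positive lapses
`N`, `M`, and spatial vielbeins (invertible matrices) `e`, `mbar`. -/
structure Params (n : ℕ) where
  p : Fin n → ℝ
  q : Fin n → ℝ
  N : ℝ
  M : ℝ
  e : SpMat n
  mbar : SpMat n
  N_pos : 0 < N
  M_pos : 0 < M
  e_unit : IsUnit e.det
  mbar_unit : IsUnit mbar.det

namespace Params

variable {n : ℕ} (P : Params n)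

/-- The Lorentz factor `λ = (1 + pᵀ p)^{1/2}`. -/
def lorentzFactor : ℝ := Real.sqrt (1 + P.p ⬝ᵥ P.p)

/-- The velocity `v = p λ⁻¹`. -/
def v : Fin n → ℝ := P.lorentzFactor⁻¹ • P.p

/-- The spatial part `Λ̂ = (1 + p pᵀ)^{1/2}` of the Lorentz boost. -/
def boost : SpMat n := principalSqrt (1 + Matrix.vecMulVec P.p P.p)

/-- `R̄ = m̄^{-1,T} eᵀ Λ̂`. -/
def Rbar : SpMat n := (P.mbar⁻¹)ᵀ * P.eᵀ * P.boost

/-- `R̂ = (R̄ᵀ R̄)^{1/2} R̄⁻¹`. -/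
def Rhat : SpMat n := principalSqrt (P.Rbarᵀ * P.Rbar) * P.Rbar⁻¹

/-- The rotated vielbein `m = R̂ m̄`. -/
def m : SpMat n := P.Rhat * P.mbar

/-- The spatial metric `γ = eᵀ e` of `g`. -/
def γ : SpMat n := P.eᵀ * P.e

/-- The spatial metric `φ = m̄ᵀ m̄` of `f`. -/
def φ : SpMat n := P.mbarᵀ * P.mbar

/-- The spatial metric `χ = eᵀ Λ̂ m` of the mean metric. -/
def χ : SpMat n := P.eᵀ * P.boost * P.m

/-- The lapse of the mean metric, `H² = N M λ⁻¹`. -/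
def H : ℝ := Real.sqrt (P.N * P.M * P.lorentzFactor⁻¹)

/-- The shift `q + N e⁻¹ p λ⁻¹` of `g`. -/
def shiftG : Fin n → ℝ := P.q + P.N • (P.e⁻¹ *ᵥ P.v)

/-- The shift `q - M m⁻¹ p λ⁻¹` of `f`. -/
def shiftF : Fin n → ℝ := P.q - P.M • (P.m⁻¹ *ᵥ P.v)

/-- The metric `g` produced by the parameters. -/
def g : STMat n := admMetric P.N P.shiftG P.γ

/-- The metric `f` produced by the parameters. -/
def f : STMat n := admMetric P.M P.shiftF P.φ

/-- The mean metric `h` produced by the parameters; its Cauchy frame is `Ξ[q]`. -/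
def h : STMat n := admMetric P.H P.q P.χ

/-- The square root `S = g⁻¹ h` produced by the parameters. -/
def S : STMat n := P.g⁻¹ * P.h

end Params

end GeomMeanParam

end

/-! In coframes everything is one product. With `v = p/λ`, `Λ` the boost with vector `p`, `E = frame
N (N v) e * Ξ[q]` and `L = frame M (-M v) m * Ξ[q]`, one has `g = Eᵀ η E`, `f = Lᵀ η L` and `h = Eᵀ
η Λ L`. The shifts make `h` block diagonal in the frame `Ξ[q]`, and the polar rotation `R̂` makes
its spatial block symmetric positive definite. Since `h` is symmetric and `Λ` preserves `η`, `h g⁻¹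
h = f` (`mean_mul_inv_mul_mean`), so `S = g⁻¹ h` squares to `g⁻¹ f`.

The spectrum of `S` is controlled although `g` and `h` are indefinite: reversing the time row of `g
S = h` in the frame `Ξ[q]` gives `A S = B`, where `A` has positive definite symmetric part and `B`
is congruent to `diag(H², χ)`. Lyapunov's theorem says that, for symmetric `B`, positive
definiteness is equivalent to `S` having spectrum in the right half plane. Validity uses one
direction (`spectrum_re_pos_of_mul_eq`), exhaustiveness the other (`posDef_of_spectrum_re_pos`).

For exhaustiveness, uniqueness of principal roots makes `g S` symmetric. Hence `E S L⁻¹`, for any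
coframes of `g` and `f`, is a Lorentz transformation, and its polar decomposition yields `p`, a
rotation and a time sign. Symmetry of `g S` fixes the relative shift; Lyapunov makes the sign `+1`
and `χ` positive definite, which forces the rotation to be `R̂`. -/

open scoped Matrix

noncomputable section

namespace GeomMeanParam

/-! ### Half-plane spectra and principal square roots -/

section LinearAlgebra

variable {ι : Type*} [Fintype ι]

theorem re_map_mulVec (S : Matrix ι ι ℝ) (z : ι → ℂ) :
    (fun i => ((S.map (algebraMap ℝ ℂ) *ᵥ z) i).re) = S *ᵥ fun i => (z i).re := by
  ext i
  simp [Matrix.mulVec, dotProduct]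

theorem im_map_mulVec (S : Matrix ι ι ℝ) (z : ι → ℂ) :
    (fun i => ((S.map (algebraMap ℝ ℂ) *ᵥ z) i).im) = S *ᵥ fun i => (z i).im := by
  ext i
  simp [Matrix.mulVec, dotProduct]

theorem dotProduct_mulVec_comm {B : Matrix ι ι ℝ} (hB : Bᵀ = B) (x y : ι → ℝ) :
    x ⬝ᵥ B *ᵥ y = y ⬝ᵥ B *ᵥ x := by
  rw [Matrix.dotProduct_mulVec, ← Matrix.mulVec_transpose, hB, dotProduct_comm]

theorem posDef_iff {B : Matrix ι ι ℝ} :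
    B.PosDef ↔ Bᵀ = B ∧ ∀ x, x ≠ 0 → 0 < x ⬝ᵥ B *ᵥ x := by
  rw [Matrix.posDef_iff_dotProduct_mulVec]
  simp [Matrix.IsHermitian, Matrix.conjTranspose_eq_transpose_of_trivial]

variable [DecidableEq ι]

theorem mem_spectrum_iff_exists_mulVec {M : Matrix ι ι ℂ} {μ : ℂ} :
    μ ∈ spectrum ℂ M ↔ ∃ z : ι → ℂ, z ≠ 0 ∧ M *ᵥ z = μ • z := by
  rw [spectrum.mem_iff, Matrix.isUnit_iff_isUnit_det, isUnit_iff_ne_zero, not_not,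
    ← Matrix.exists_mulVec_eq_zero_iff]
  refine exists_congr fun z => and_congr_right fun _ => ?_
  rw [Matrix.sub_mulVec, sub_eq_zero, Matrix.algebraMap_eq_diagonal, eq_comm]
  have : (Matrix.diagonal (algebraMap ℂ (ι → ℂ) μ)) *ᵥ z = μ • z := by
    ext i
    simp [Matrix.mulVec_diagonal]
  rw [this]

/-- If `A` has positive definite symmetric part and `B` is positive definite, the solution `S` of
`A S = B` has its spectrum in the open right half plane. -/
theorem spectrum_re_pos_of_mul_eq {A S B : Matrix ι ι ℝ}
    (hA : ∀ x, x ≠ 0 → 0 < x ⬝ᵥ A *ᵥ x) (hB : B.PosDef) (h : A * S = B) :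
    ∀ μ ∈ spectrum ℂ (S.map (algebraMap ℝ ℂ)), 0 < μ.re := by
  intro μ hμ
  obtain ⟨z, hz, hSz⟩ := mem_spectrum_iff_exists_mulVec.1 hμ
  obtain ⟨hBs, hBp⟩ := posDef_iff.1 hB
  set r : ι → ℝ := fun i => (z i).re with hr
  set s : ι → ℝ := fun i => (z i).im with hs
  have h1 : S *ᵥ r = μ.re • r - μ.im • s := by
    rw [hr, ← re_map_mulVec, hSz]; ext i; simp [hs]
  have h2 : S *ᵥ s = μ.re • s + μ.im • r := by
    rw [hs, ← im_map_mulVec, hSz]; ext i; simp [hr]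
  have hrs : r ≠ 0 ∨ s ≠ 0 := by
    by_contra! hc
    refine hz (funext fun i => Complex.ext ?_ ?_)
    · simpa using congrFun hc.1 i
    · simpa using congrFun hc.2 i
  have nonneg : ∀ {D : Matrix ι ι ℝ}, (∀ x, x ≠ 0 → 0 < x ⬝ᵥ D *ᵥ x) →
      0 < r ⬝ᵥ D *ᵥ r + s ⬝ᵥ D *ᵥ s := by
    intro D hD
    have hn : ∀ x, 0 ≤ x ⬝ᵥ D *ᵥ x := fun x => by
      by_cases hx : x = 0
      · simp [hx]
      · exact (hD x hx).le
    rcases hrs with h | h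
    · linarith [hD r h, hn s]
    · linarith [hD s h, hn r]
  have hc := nonneg hA
  have hX := nonneg hBp
  have hsym := dotProduct_mulVec_comm hBs r s
  have e : ∀ x, B *ᵥ x = A *ᵥ (S *ᵥ x) := fun x => by rw [Matrix.mulVec_mulVec, h]
  rw [e, e, h1, h2] at hX hsym
  simp only [Matrix.mulVec_sub, Matrix.mulVec_add, Matrix.mulVec_smul, dotProduct_sub,
    dotProduct_add, dotProduct_smul, smul_eq_mul] at hX hsym
  generalize μ.re = α at *
  generalize μ.im = β at *
  generalize r ⬝ᵥ A *ᵥ r = a at *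
  generalize s ⬝ᵥ A *ᵥ s = b at *
  generalize r ⬝ᵥ A *ᵥ s = c at *
  generalize s ⬝ᵥ A *ᵥ r = d at *
  by_contra! hα
  -- For `z = r + i s`, `z* B z = μ z* A z` is real by `hsym`. This is the real part of `μ̄ (z* B z)
  -- = |μ|² z* A z`.
  have key : α * (α * a - β * c + (α * b + β * d)) = (α ^ 2 + β ^ 2) * (a + b) := by
    linear_combination (-β) * hsym
  have h3 : (α ^ 2 + β ^ 2) * (a + b) ≤ 0 := by
    rw [← key]; exact mul_nonpos_of_nonpos_of_nonneg hα hX.le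
  have h4 : α ^ 2 + β ^ 2 ≤ 0 := nonpos_of_mul_nonpos_left h3 hc
  have hα0 : α = 0 := by nlinarith
  have hβ0 : β = 0 := by nlinarith
  simp [hα0, hβ0] at hX

open Polynomial in
/-- The homogeneous Sylvester equation `X D = D Y` has only the trivial solution if the spectra
are disjoint. -/
theorem eq_zero_of_mul_eq_mul {X Y D : Matrix ι ι ℂ}
    (hd : Disjoint (spectrum ℂ X) (spectrum ℂ Y)) (h : X * D = D * Y) : D = 0 := by
  rcases isEmpty_or_nonempty ι with hι | hι
  · exact Subsingleton.elim _ _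
  have hp : ∀ p : ℂ[X], aeval X p * D = D * aeval Y p := by
    intro p
    induction p using Polynomial.induction_on' with
    | add p q hp hq => simp [add_mul, mul_add, hp, hq]
    | monomial k a =>
      have hk : X ^ k * D = D * Y ^ k := by
        induction k with
        | zero => simp
        | succ k ih => rw [pow_succ', pow_succ', mul_assoc, ih, ← mul_assoc, h, mul_assoc]
      simp only [aeval_monomial]
      rw [mul_assoc, hk, ← mul_assoc, Algebra.commutes, mul_assoc]
  -- Cayley–Hamilton kills the right-hand side, while the characteristic polynomial of `Y` evaluated
  -- at `X` is invertible: none of its roots is an eigenvalue of `X`.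
  have h0 := hp Y.charpoly
  rw [Matrix.aeval_self_charpoly, mul_zero] at h0
  have hu : IsUnit (aeval X Y.charpoly) := by
    by_contra hn
    have h1 : (0 : ℂ) ∈ spectrum ℂ (aeval X Y.charpoly) := spectrum.zero_mem ℂ hn
    rw [spectrum.map_polynomial_aeval_of_nonempty _ _ (spectrum.nonempty_of_isAlgClosed_of_finiteDimensional ℂ X)] at h1
    obtain ⟨k, hk, hk0⟩ := h1
    exact Set.disjoint_left.1 hd hk (Matrix.mem_spectrum_iff_isRoot_charpoly.2 hk0)
  exact (hu.mul_right_eq_zero).1 h0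

/-- From `X² = Y²` follows `X (X - Y) = (X - Y) (-Y)`, and the spectra of `X` and `-Y` lie on
opposite sides of the imaginary axis. -/
theorem IsPrincipalSqrt.unique {A X Y : Matrix ι ι ℝ} (hX : IsPrincipalSqrt A X)
    (hY : IsPrincipalSqrt A Y) : X = Y := by
  have hinj : Function.Injective fun M : Matrix ι ι ℝ => M.map (algebraMap ℝ ℂ) :=
    Matrix.map_injective (algebraMap ℝ ℂ).injective
  apply hinj
  rw [← sub_eq_zero]
  refine eq_zero_of_mul_eq_mul (X := X.map (algebraMap ℝ ℂ)) (Y := -Y.map (algebraMap ℝ ℂ)) ?_ ?_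
  · rw [Set.disjoint_left]
    intro μ h1 h2
    rw [← spectrum.neg_eq, Set.mem_neg] at h2
    have := hX.2 _ h1
    have := hY.2 _ h2
    simp at this
    linarith
  · have h1 := congrArg (fun M : Matrix ι ι ℝ => M.map (algebraMap ℝ ℂ)) (hX.1.trans hY.1.symm)
    simp only [Matrix.map_mul] at h1
    simp only [mul_sub, sub_mul, mul_neg, h1]
    abel

theorem principalSqrt_eq {A X : Matrix ι ι ℝ} (h : IsPrincipalSqrt A X) :
    principalSqrt A = X := by
  have hex : ∃ X, IsPrincipalSqrt A X := ⟨X, h⟩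
  rw [principalSqrt, dif_pos hex]
  exact hex.choose_spec.unique h

theorem isPrincipalSqrt_of_posDef {A X : Matrix ι ι ℝ} (hX : X.PosDef) (h : X * X = A) :
    IsPrincipalSqrt A X :=
  ⟨h, spectrum_re_pos_of_mul_eq (posDef_iff.1 Matrix.PosDef.one).2 hX (one_mul X)⟩

theorem isUnit_det_of_posDef {A : Matrix ι ι ℝ} (hA : A.PosDef) : IsUnit A.det :=
  (Matrix.isUnit_iff_isUnit_det _).1 hA.isUnit

/-- Congruence by an invertible matrix preserves positive definiteness. -/
theorem posDef_transpose_mul_mul {A c : Matrix ι ι ℝ} (hA : A.PosDef) (hc : IsUnit c.det) :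
    (cᵀ * A * c).PosDef := by
  rw [← Matrix.conjTranspose_eq_transpose_of_trivial]
  exact hA.conjTranspose_mul_mul_same (Matrix.mulVec_injective_of_isUnit
    ((Matrix.isUnit_iff_isUnit_det _).2 hc))

theorem posDef_transpose_mul_self {c : Matrix ι ι ℝ} (hc : IsUnit c.det) : (cᵀ * c).PosDef := by
  simpa using posDef_transpose_mul_mul Matrix.PosDef.one hc

theorem exists_posDef_mul_self {A : Matrix ι ι ℝ} (hA : A.PosDef) :
    ∃ X : Matrix ι ι ℝ, X.PosDef ∧ X * X = A := by
  have hs := hA.isHermitian.spectral_theorem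
  set U := hA.isHermitian.eigenvectorUnitary
  set d := hA.isHermitian.eigenvalues with hd
  have hdp : ∀ i, 0 < d i := hA.eigenvalues_pos
  have hU : (U : Matrix ι ι ℝ)ᵀ * (U : Matrix ι ι ℝ) = 1 := by
    simpa [Matrix.star_eq_conjTranspose] using Unitary.star_mul_self_of_mem U.2
  have hU' : (U : Matrix ι ι ℝ) * (U : Matrix ι ι ℝ)ᵀ = 1 := mul_eq_one_comm.1 hU
  refine ⟨U * Matrix.diagonal (fun i => √(d i)) * (U : Matrix ι ι ℝ)ᵀ, ?_, ?_⟩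
  · have := posDef_transpose_mul_mul (c := (U : Matrix ι ι ℝ)ᵀ)
      (Matrix.PosDef.diagonal fun i => Real.sqrt_pos.2 (hdp i))
      (Matrix.isUnit_det_of_left_inverse hU')
    simpa using this
  · rw [hs, Unitary.conjStarAlgAut_apply]
    simp only [Matrix.star_eq_conjTranspose, Matrix.conjTranspose_eq_transpose_of_trivial]
    calc _ = U * Matrix.diagonal (fun i => √(d i)) * ((U : Matrix ι ι ℝ)ᵀ * U) *
          Matrix.diagonal (fun i => √(d i)) * (U : Matrix ι ι ℝ)ᵀ := by simp only [mul_assoc]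
      _ = _ := by
        rw [hU, mul_one, mul_assoc (U : Matrix ι ι ℝ), Matrix.diagonal_mul_diagonal]
        congr 3
        ext i
        simp [Real.mul_self_sqrt (hdp i).le]

end LinearAlgebra

/-! ### Lyapunov's theorem via the Cayley transform -/

section Lyapunov

attribute [local instance] Matrix.linftyOpNormedRing Matrix.linftyOpNormedAlgebra

variable {ι : Type*} [Fintype ι] [DecidableEq ι]

open Filter Topology in
-- By Gelfand's formula `‖C ^ k‖` is eventually below `r ^ k` for some `r < 1`.
theorem tendsto_pow_of_spectralRadius_lt_one {C : Matrix ι ι ℂ} (h : spectralRadius ℂ C < 1) :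
    Tendsto (fun k => C ^ k) atTop (𝓝 0) := by
  obtain ⟨r, hr1, hr2⟩ := exists_between h
  have h1 := spectrum.pow_nnnorm_pow_one_div_tendsto_nhds_spectralRadius C
  have h2 := h1.eventually (gt_mem_nhds hr1)
  have hr0 : Tendsto (fun k : ℕ => r ^ k) atTop (𝓝 0) :=
    ENNReal.tendsto_pow_atTop_nhds_zero_of_lt_one hr2
  have h3 : Tendsto (fun k : ℕ => (‖C ^ k‖₊ : ENNReal)) atTop (𝓝 0) := by
    refine tendsto_of_tendsto_of_tendsto_of_le_of_le' tendsto_const_nhds hr0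
      (Eventually.of_forall fun _ => zero_le) ?_
    filter_upwards [h2, eventually_gt_atTop 0] with k hk hk0
    have := pow_le_pow_left' hk.le k
    rwa [← ENNReal.rpow_natCast, ← ENNReal.rpow_mul, one_div,
      inv_mul_cancel₀ (by positivity), ENNReal.rpow_one] at this
  have h4 : Tendsto (fun k : ℕ => ‖C ^ k‖₊) atTop (𝓝 0) := by
    exact ENNReal.tendsto_coe.1 h3
  exact tendsto_zero_iff_norm_tendsto_zero.2 (NNReal.tendsto_coe.2 h4)

end Lyapunov

section Lyapunov

variable {ι : Type*} [Fintype ι] [DecidableEq ι]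

open Filter Topology in
theorem tendsto_pow_mulVec {C : Matrix ι ι ℝ}
    (hC : ∀ ν ∈ spectrum ℂ (C.map (algebraMap ℝ ℂ)), ‖ν‖ < 1) (y : ι → ℝ) :
    Tendsto (fun k => C ^ k *ᵥ y) atTop (𝓝 0) := by
  rcases isEmpty_or_nonempty ι with hι | hι
  · exact tendsto_const_nhds.congr fun _ => Subsingleton.elim _ _
  have hsr : spectralRadius ℂ (C.map (algebraMap ℝ ℂ)) < 1 := by
    let _ := Matrix.linftyOpNormedRing (n := ι) (α := ℂ)
    let _ := Matrix.linftyOpNormedAlgebra (n := ι) (R := ℂ) (α := ℂ)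
    refine spectrum.spectralRadius_lt_of_forall_lt_of_nonempty (r := 1)
      (spectrum.nonempty_of_isAlgClosed_of_finiteDimensional ℂ _) fun k hk => ?_
    exact_mod_cast hC k hk
  have h1 := tendsto_pow_of_spectralRadius_lt_one hsr
  have h2 : ∀ i j, Tendsto (fun k => (C ^ k) i j) atTop (𝓝 0) := by
    intro i j
    have h3 : Tendsto (fun k => (C.map (algebraMap ℝ ℂ) ^ k) i j) atTop (𝓝 0) :=
      ((continuous_apply_apply i j).tendsto (0 : Matrix ι ι ℂ)).comp h1
    have h4 := (Complex.continuous_re.tendsto 0).comp h3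
    have h5 : ∀ k, C.map (algebraMap ℝ ℂ) ^ k = (C ^ k).map (algebraMap ℝ ℂ) := fun k =>
      (map_pow (algebraMap ℝ ℂ).mapMatrix C k).symm
    refine h4.congr fun k => ?_
    rw [Function.comp_apply, h5]
    simp
  rw [tendsto_pi_nhds]
  intro i
  have : Tendsto (fun k => ∑ j, (C ^ k) i j * y j) atTop (𝓝 (∑ j, 0 * y j)) :=
    tendsto_finsetSum _ fun j _ => (h2 i j).mul_const _
  simp only [zero_mul, Finset.sum_const_zero] at this
  exact this

/-- Lyapunov: if `A` has positive definite symmetric part, `B` is symmetric and the solution of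
`A S = B` has its spectrum in the open right half plane, then `B` is positive definite. -/
theorem posDef_of_spectrum_re_pos {A S B : Matrix ι ι ℝ}
    (hA : ∀ x, x ≠ 0 → 0 < x ⬝ᵥ A *ᵥ x) (hB : Bᵀ = B) (h : A * S = B)
    (hS : ∀ μ ∈ spectrum ℂ (S.map (algebraMap ℝ ℂ)), 0 < μ.re) : B.PosDef := by
  -- Used with `a = -1`, so that `S + 1` is invertible, and with `a = 0`, so that `S` is injective.
  have not_eig : ∀ a : ℝ, a ≤ 0 → ∀ x : ι → ℝ, x ≠ 0 → S *ᵥ x ≠ a • x := by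
    intro a ha x hx hSx
    have : ((a : ℝ) : ℂ) ∈ spectrum ℂ (S.map (algebraMap ℝ ℂ)) := by
      refine mem_spectrum_iff_exists_mulVec.2 ⟨fun i => (x i : ℂ), ?_, ?_⟩
      · exact fun hc => hx (funext fun i => by simpa using congrFun hc i)
      · ext i
        have := congrArg (fun t : ℝ => (t : ℂ)) (congrFun hSx i)
        simpa [Matrix.mulVec, dotProduct] using this
    have := hS _ this
    simp at this
    linarith
  have hdet : IsUnit (S + 1).det := by
    rw [isUnit_iff_ne_zero]
    intro h0
    obtain ⟨x, hx, hx0⟩ := Matrix.exists_mulVec_eq_zero_iff.2 h0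
    rw [Matrix.add_mulVec, Matrix.one_mulVec] at hx0
    exact not_eig (-1) (by norm_num) x hx (by rw [neg_one_smul]; exact eq_neg_of_add_eq_zero_left hx0)
  set V := (S + 1)⁻¹ with hV
  have hV1 : (S + 1) * V = 1 := Matrix.mul_nonsing_inv _ hdet
  -- The Cayley transform carries the right half plane to the unit disc, so the powers of `C` tend
  -- to zero.
  set C := (S - 1) * V with hC
  have hCspec : ∀ ν ∈ spectrum ℂ (C.map (algebraMap ℝ ℂ)), ‖ν‖ < 1 := by
    intro ν hν
    obtain ⟨w, hw, hCw⟩ := mem_spectrum_iff_exists_mulVec.1 hν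
    set Sc := S.map (algebraMap ℝ ℂ) with hSc
    set z := V.map (algebraMap ℝ ℂ) *ᵥ w with hz
    have hSz : Sc *ᵥ z + z = w := by
      have : (Sc + 1) * V.map (algebraMap ℝ ℂ) = 1 := by
        have := congrArg (algebraMap ℝ ℂ).mapMatrix hV1
        simpa [map_mul, map_add, hSc] using this
      rw [← Matrix.one_mulVec w, ← this, ← Matrix.mulVec_mulVec, Matrix.add_mulVec,
        Matrix.one_mulVec]
    have hSz' : Sc *ᵥ z - z = ν • w := by
      have : (Sc - 1) * V.map (algebraMap ℝ ℂ) = C.map (algebraMap ℝ ℂ) := by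
        have := congrArg (algebraMap ℝ ℂ).mapMatrix hC
        simpa [map_mul, map_sub, hSc] using this.symm
      rw [← hCw, ← this, ← Matrix.mulVec_mulVec, Matrix.sub_mulVec, Matrix.one_mulVec]
    have hz0 : z ≠ 0 := by
      intro h0
      rw [h0] at hSz
      exact hw (by simpa using hSz.symm)
    have e1 : (1 - ν) • (Sc *ᵥ z) = (1 + ν) • z := by
      rw [← hSz] at hSz'
      ext i
      have := congrFun hSz' i
      simp at this ⊢
      linear_combination this
    have hν1 : 1 - ν ≠ 0 := by
      intro h0
      rw [h0, zero_smul] at e1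
      have : (1 + ν) = 0 := by
        by_contra hne
        exact hz0 ((smul_eq_zero.1 e1.symm).resolve_left hne)
      have h2 : (2 : ℂ) = 0 := by linear_combination h0 + this
      norm_num at h2
    -- The inverse Cayley transform turns the eigenvalue `ν` of `C` into an eigenvalue of `S`.
    have hμ := hS ((1 - ν)⁻¹ * (1 + ν)) (mem_spectrum_iff_exists_mulVec.2 ⟨z, hz0, by
      rw [mul_smul, ← e1, smul_smul, inv_mul_cancel₀ hν1, one_smul]⟩)
    have hn : 0 < Complex.normSq (1 - ν) := Complex.normSq_pos.2 hν1
    have h5 : ((1 - ν)⁻¹ * (1 + ν)).re * Complex.normSq (1 - ν) = 1 - Complex.normSq ν := by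
      rw [Complex.mul_re, Complex.inv_re, Complex.inv_im]
      field_simp
      simp [Complex.normSq_apply]
      ring
    have h6 : Complex.normSq ν < 1 := by nlinarith [mul_pos hμ hn]
    rw [Complex.normSq_eq_norm_sq] at h6
    nlinarith [norm_nonneg ν]
  -- With `y = S x + x` and `C y = S x - x`, the drop of the form is `4 x·B(S x) = 4 (S x)·A(S x)`.
  have step : ∀ y, y ≠ 0 → (C *ᵥ y) ⬝ᵥ B *ᵥ (C *ᵥ y) < y ⬝ᵥ B *ᵥ y := by
    intro y hy
    set x := V *ᵥ y with hx
    have hyx : y = S *ᵥ x + x := by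
      calc y = ((S + 1) * V) *ᵥ y := by rw [hV1, Matrix.one_mulVec]
        _ = _ := by rw [← Matrix.mulVec_mulVec, Matrix.add_mulVec, Matrix.one_mulVec]
    have hCy : C *ᵥ y = S *ᵥ x - x := by
      rw [hC, ← Matrix.mulVec_mulVec, Matrix.sub_mulVec, Matrix.one_mulVec]
    have hx0 : x ≠ 0 := by
      intro h0
      rw [h0] at hyx
      exact hy (by simpa using hyx)
    have hSx : S *ᵥ x ≠ 0 := fun h0 => not_eig 0 le_rfl x hx0 (by simpa using h0)
    have hpos := hA _ hSx
    rw [Matrix.mulVec_mulVec x A S, h] at hpos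
    rw [hCy, hyx]
    have hsym := dotProduct_mulVec_comm hB x (S *ᵥ x)
    simp only [Matrix.mulVec_add, Matrix.mulVec_sub, dotProduct_add, dotProduct_sub,
      add_dotProduct, sub_dotProduct]
    linarith
  refine posDef_iff.2 ⟨hB, fun y hy => ?_⟩
  set a : ℕ → ℝ := fun k => (C ^ k *ᵥ y) ⬝ᵥ B *ᵥ (C ^ k *ᵥ y) with ha
  have hanti : Antitone a := antitone_nat_of_succ_le fun k => by
    simp only [ha, pow_succ', ← Matrix.mulVec_mulVec]
    by_cases h0 : C ^ k *ᵥ y = 0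
    · simp [h0]
    · exact (step _ h0).le
  have hlim : Filter.Tendsto a Filter.atTop (nhds 0) := by
    have hcont : Continuous fun x : ι → ℝ => x ⬝ᵥ B *ᵥ x := by
      simp only [dotProduct, Matrix.mulVec]; fun_prop
    have := (hcont.tendsto 0).comp (tendsto_pow_mulVec hCspec y)
    simp only [zero_dotProduct] at this
    exact this
  -- The values decrease to zero; starting from `a 1` leaves one strict drop, which makes `a 0`
  -- positive.
  have h0 : 0 ≤ a 1 := hanti.le_of_tendsto hlim 1
  have h1 := step y hy
  simp only [ha, pow_one] at h0
  linarith

end Lyapunov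

/-! ### Frames, shears and the lapse-shift form of a metric -/

section Blocks

variable {n : ℕ}

theorem mul_replicateCol (A : SpMat n) (x : Fin n → ℝ) :
    A * Matrix.replicateCol Unit x = Matrix.replicateCol Unit (A *ᵥ x) :=
  (Matrix.replicateCol_mulVec A x).symm

theorem replicateRow_mul (A : SpMat n) (x : Fin n → ℝ) :
    Matrix.replicateRow Unit x * A = Matrix.replicateRow Unit (x ᵥ* A) :=
  (Matrix.replicateRow_vecMul A x).symm

theorem replicateRow_mul_replicateCol_eq (x y : Fin n → ℝ) :
    Matrix.replicateRow Unit x * Matrix.replicateCol Unit y =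
      (x ⬝ᵥ y) • (1 : Matrix Unit Unit ℝ) := by
  ext i j
  simp [Matrix.mul_apply, dotProduct]

theorem replicateCol_mul_replicateRow_eq (x y : Fin n → ℝ) :
    Matrix.replicateCol Unit x * Matrix.replicateRow Unit y = Matrix.vecMulVec x y :=
  (Matrix.vecMulVec_eq Unit x y).symm

theorem minkowski_eq : minkowski n = Matrix.fromBlocks ((-1 : ℝ) • 1) 0 0 1 := by
  rw [minkowski, neg_one_smul]

theorem minkowski_transpose : (minkowski n)ᵀ = minkowski n := by
  simp [minkowski, Matrix.fromBlocks_transpose]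

theorem minkowski_mul_self : minkowski n * minkowski n = 1 := by
  simp [minkowski, Matrix.fromBlocks_multiply]

theorem det_minkowski : (minkowski n).det = -1 := by
  simp [minkowski]

theorem shear_add (x y : Fin n → ℝ) : shear (x + y) = shear x * shear y := by
  simp [shear, Matrix.fromBlocks_multiply, Matrix.replicateCol_add]

theorem det_shear (x : Fin n → ℝ) : (shear x).det = 1 := by
  simp [shear]

theorem isUnit_det_shear (x : Fin n → ℝ) : IsUnit (shear x).det := by
  simp [det_shear]

/-- The coframe with lapse `N`, spatial vielbein `e`, whose spatial legs have time components
`x`. -/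
def frame (N : ℝ) (x : Fin n → ℝ) (e : SpMat n) : STMat n :=
  Matrix.fromBlocks (N • 1) 0 (Matrix.replicateCol Unit x) e

theorem frame_mul_shear (N : ℝ) (x w : Fin n → ℝ) (e : SpMat n) :
    frame N x e * shear w = frame N (x + e *ᵥ w) e := by
  simp [frame, shear, Matrix.fromBlocks_multiply, Matrix.replicateCol_add, mul_replicateCol]

/-- Converts an excess shift `w` into time components of the spatial legs, so that the frames of `g`
and `f` share the factor `shear q`. -/
theorem frame_mul_shear_add (N : ℝ) (q w : Fin n → ℝ) (e : SpMat n) :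
    frame N 0 e * shear (q + w) = frame N (e *ᵥ w) e * shear q := by
  rw [add_comm, shear_add, ← mul_assoc, frame_mul_shear, zero_add]

theorem isUnit_det_frame {N : ℝ} (hN : N ≠ 0) (x : Fin n → ℝ) {e : SpMat n} (he : IsUnit e.det) :
    IsUnit (frame N x e).det := by
  rw [frame, Matrix.det_fromBlocks_zero₁₂]
  simpa [hN] using he

theorem isUnit_det_mul_shear {E : STMat n} (hE : IsUnit E.det) (x : Fin n → ℝ) :
    IsUnit (E * shear x).det := by
  rwa [Matrix.det_mul, det_shear, mul_one]

theorem admMetric_eq (N : ℝ) (x : Fin n → ℝ) (e : SpMat n) :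
    admMetric N x (eᵀ * e) = (frame N 0 e * shear x)ᵀ * minkowski n * (frame N 0 e * shear x) := by
  have : Matrix.fromBlocks ((-N ^ 2) • (1 : Matrix Unit Unit ℝ)) 0 0 (eᵀ * e) =
      (frame N 0 e)ᵀ * minkowski n * frame N 0 e := by
    simp [frame, minkowski_eq, Matrix.fromBlocks_transpose, Matrix.fromBlocks_multiply, smul_smul,
      sq]
  rw [admMetric, this, Matrix.transpose_mul]
  simp only [mul_assoc]

theorem isLorentzian_admMetric {N : ℝ} (hN : N ≠ 0) (x : Fin n → ℝ) {e : SpMat n}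
    (he : IsUnit e.det) : IsLorentzian (admMetric N x (eᵀ * e)) :=
  ⟨_, isUnit_det_mul_shear (isUnit_det_frame hN 0 he) x, admMetric_eq N x e⟩

theorem toBlocks₂₂_admMetric (N : ℝ) (x : Fin n → ℝ) (γ : SpMat n) :
    (admMetric N x γ).toBlocks₂₂ = γ := by
  simp [admMetric, shear, Matrix.fromBlocks_transpose, Matrix.fromBlocks_multiply]

theorem IsLorentzian.transpose_eq {g : STMat n} (hg : IsLorentzian g) : gᵀ = g := by
  obtain ⟨E, -, rfl⟩ := hg
  simp only [Matrix.transpose_mul, Matrix.transpose_transpose, minkowski_transpose, mul_assoc]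

theorem IsLorentzian.det_neg {g : STMat n} (hg : IsLorentzian g) : g.det < 0 := by
  obtain ⟨E, hE, rfl⟩ := hg
  rw [Matrix.det_mul, Matrix.det_mul, Matrix.det_transpose, det_minkowski]
  have := pow_pos (abs_pos.2 hE.ne_zero) 2
  rw [sq_abs] at this
  linarith

theorem IsLorentzian.isUnit_det {g : STMat n} (hg : IsLorentzian g) : IsUnit g.det :=
  isUnit_iff_ne_zero.2 hg.det_neg.ne

theorem fromBlocks_components (T : STMat n) :
    T = Matrix.fromBlocks (T (.inl ()) (.inl ()) • 1)
      (Matrix.replicateRow Unit fun j => T (.inl ()) (.inr j))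
      (Matrix.replicateCol Unit fun i => T (.inr i) (.inl ())) T.toBlocks₂₂ := by
  ext (i | i) (j | j) <;> simp [Matrix.toBlocks₂₂]

theorem isUnit_det_of_transpose_mul_self {e : SpMat n} (h : (eᵀ * e).PosDef) : IsUnit e.det := by
  have := (isUnit_det_of_posDef h)
  rw [Matrix.det_mul, Matrix.det_transpose] at this
  exact isUnit_of_mul_isUnit_left this

/-- A Lorentzian metric for which the slice is spacelike has a lapse and a shift. -/
theorem IsLorentzian.exists_eq_admMetric {g : STMat n} (hg : IsLorentzian g)
    (hs : SpacelikeSlice g) : ∃ N > 0, ∃ x, g = admMetric N x g.toBlocks₂₂ := by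
  set γ := g.toBlocks₂₂ with hγ
  set a := g (.inl ()) (.inl ())
  set β : Fin n → ℝ := fun i => g (.inr i) (.inl ()) with hβ
  have hγu := isUnit_det_of_posDef hs
  have hγs : γᵀ = γ := (posDef_iff.1 hs).1
  have hcomp : g = Matrix.fromBlocks (a • 1) (Matrix.replicateRow Unit β)
      (Matrix.replicateCol Unit β) γ := by
    have h1 : (fun j => g (.inl ()) (.inr j)) = β := by
      funext j
      exact congrFun (congrFun hg.transpose_eq (.inr j)) (.inl ())
    conv_lhs => rw [fromBlocks_components g, h1]
  set x := γ⁻¹ *ᵥ β with hx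
  have hγx : γ *ᵥ x = β := by
    rw [hx, Matrix.mulVec_mulVec, Matrix.mul_nonsing_inv _ hγu, Matrix.one_mulVec]
  have hxγ : x ᵥ* γ = β := by rw [← Matrix.mulVec_transpose, hγs, hγx]
  have hform : g = (shear x)ᵀ * Matrix.fromBlocks ((a - β ⬝ᵥ x) • 1) 0 0 γ * shear x := by
    rw [hcomp]
    simp [shear, Matrix.fromBlocks_transpose, Matrix.fromBlocks_multiply, mul_replicateCol,
      replicateRow_mul, hγx, hxγ, replicateRow_mul_replicateCol_eq, ← add_smul]
  -- This is the Schur complement of `γ`; its sign follows from `det g < 0 < det γ`.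
  have hneg : a - β ⬝ᵥ x < 0 := by
    have h1 := hg.det_neg
    rw [hform, Matrix.det_mul, Matrix.det_mul, Matrix.det_transpose, det_shear,
      Matrix.det_fromBlocks_zero₁₂] at h1
    simp only [one_mul, mul_one, Matrix.det_smul, Fintype.card_unit, pow_one, Matrix.det_one] at h1
    have h2 : 0 < γ.det := hs.det_pos
    by_contra! h3
    exact absurd h1 (not_lt.2 (mul_nonneg h3 h2.le))
  refine ⟨√(-(a - β ⬝ᵥ x)), Real.sqrt_pos.2 (by linarith), x, ?_⟩
  rw [admMetric, Real.sq_sqrt (by linarith), neg_neg]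
  exact hform

end Blocks

/-! ### Lorentz boosts and the Lorentz polar decomposition -/

section Boost

variable {n : ℕ} (p : Fin n → ℝ)

/-- The Lorentz factor of the boost vector `p`. -/
def gammaFactor : ℝ := Real.sqrt (1 + p ⬝ᵥ p)

/-- The closed form `1 + p pᵀ / (1 + λ)` of the spatial part of a boost. -/
def spatialBoost : SpMat n := 1 + (1 + gammaFactor p)⁻¹ • Matrix.vecMulVec p p

/-- The Lorentz boost with boost vector `p`. -/
def lorentzBoost : STMat n :=
  Matrix.fromBlocks (gammaFactor p • 1) (Matrix.replicateRow Unit p)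
    (Matrix.replicateCol Unit p) (spatialBoost p)

theorem dotProduct_self_nonneg : 0 ≤ p ⬝ᵥ p :=
  Finset.sum_nonneg fun i _ => mul_self_nonneg (p i)

theorem dotProduct_self_pos {p : Fin n → ℝ} (hp : p ≠ 0) : 0 < p ⬝ᵥ p :=
  lt_of_le_of_ne (dotProduct_self_nonneg p) fun h => hp (dotProduct_self_eq_zero.1 h.symm)

theorem gammaFactor_sq : gammaFactor p ^ 2 = 1 + p ⬝ᵥ p :=
  Real.sq_sqrt (by linarith [dotProduct_self_nonneg p])

theorem gammaFactor_pos : 0 < gammaFactor p :=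
  Real.sqrt_pos.2 (by linarith [dotProduct_self_nonneg p])

theorem spatialBoost_transpose : (spatialBoost p)ᵀ = spatialBoost p := by
  simp [spatialBoost, Matrix.transpose_vecMulVec]

theorem spatialBoost_posDef : (spatialBoost p).PosDef := by
  refine posDef_iff.2 ⟨spatialBoost_transpose p, fun x hx => ?_⟩
  have h1 : x ⬝ᵥ spatialBoost p *ᵥ x = x ⬝ᵥ x + (1 + gammaFactor p)⁻¹ * (p ⬝ᵥ x) ^ 2 := by
    simp [spatialBoost, Matrix.add_mulVec, Matrix.smul_mulVec, Matrix.vecMulVec_mulVec,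
      dotProduct_comm x p, sq]
  rw [h1]
  have := dotProduct_self_pos hx
  have := gammaFactor_pos p
  positivity

/-- The eigenvalue is `1 + |p|² / (1 + λ)`, and `|p|² = λ² - 1`. -/
theorem spatialBoost_mulVec_self : spatialBoost p *ᵥ p = gammaFactor p • p := by
  have h0 := gammaFactor_sq p
  have h1 := gammaFactor_pos p
  have h2 : (1 + gammaFactor p)⁻¹ * (p ⬝ᵥ p) = gammaFactor p - 1 := by
    field_simp
    linarith
  simp only [spatialBoost, Matrix.add_mulVec, Matrix.smul_mulVec, Matrix.vecMulVec_mulVec,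
    Matrix.one_mulVec]
  ext i
  simp
  linear_combination p i * h2

theorem spatialBoost_mul_self :
    spatialBoost p * spatialBoost p = 1 + Matrix.vecMulVec p p := by
  have h0 := gammaFactor_sq p
  have h1 := gammaFactor_pos p
  have h2 : Matrix.vecMulVec p p * spatialBoost p = gammaFactor p • Matrix.vecMulVec p p := by
    rw [Matrix.vecMulVec_mul, ← Matrix.mulVec_transpose, spatialBoost_transpose,
      spatialBoost_mulVec_self, Matrix.vecMulVec_smul]
  nth_rw 1 [spatialBoost]
  rw [add_mul, one_mul, Matrix.smul_mul, h2, spatialBoost, add_assoc]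
  congr 1
  ext i j
  simp [Matrix.vecMulVec_apply]
  field_simp

theorem lorentzBoost_transpose : (lorentzBoost p)ᵀ = lorentzBoost p := by
  simp [lorentzBoost, Matrix.fromBlocks_transpose, spatialBoost_transpose]

theorem lorentzBoost_mul_minkowski_mul :
    lorentzBoost p * minkowski n * lorentzBoost p = minkowski n := by
  have h0 := gammaFactor_sq p
  have h1 : p ᵥ* spatialBoost p = gammaFactor p • p := by
    rw [← Matrix.mulVec_transpose, spatialBoost_transpose, spatialBoost_mulVec_self]
  rw [lorentzBoost, minkowski_eq, Matrix.fromBlocks_multiply, Matrix.fromBlocks_multiply]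
  congr 1
  · simp [replicateRow_mul_replicateCol_eq, smul_smul]
    rw [← neg_smul, ← add_smul, show -(gammaFactor p * gammaFactor p) + p ⬝ᵥ p = -1 by linarith]
    simp
  · simp [replicateRow_mul, h1]
  · simp [mul_replicateCol, spatialBoost_mulVec_self]
  · simp [replicateCol_mul_replicateRow_eq, spatialBoost_mul_self]

/-- The velocity of the boost vector `p`. -/
def velocity : Fin n → ℝ := (gammaFactor p)⁻¹ • p

theorem spatialBoost_mulVec_velocity : spatialBoost p *ᵥ velocity p = p := by
  rw [velocity, Matrix.mulVec_smul, spatialBoost_mulVec_self, smul_smul,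
    inv_mul_cancel₀ (gammaFactor_pos p).ne', one_smul]

/-- The legs `N v` cancel the upper right block, because the spatial boost maps `v` to `p`. The
vector `y` stays free: validity sets `y = -M v` to kill the column, whereas exhaustiveness recovers
`y` from the column being zero. -/
theorem frame_minkowski_boost_frame (N M : ℝ) (y : Fin n → ℝ) (e m : SpMat n) :
    (frame N (N • velocity p) e)ᵀ * minkowski n * lorentzBoost p * frame M y m =
      Matrix.fromBlocks ((-(N * M * (gammaFactor p)⁻¹)) • 1) 0
        (Matrix.replicateCol Unit (eᵀ *ᵥ (M • p + spatialBoost p *ᵥ y)))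
        (eᵀ * spatialBoost p * m) := by
  have h0 := gammaFactor_sq p
  have hpos := gammaFactor_pos p
  have h1 : velocity p ᵥ* spatialBoost p = p := by
    rw [← Matrix.mulVec_transpose, spatialBoost_transpose, spatialBoost_mulVec_velocity]
  have h2 : velocity p ⬝ᵥ p = gammaFactor p - (gammaFactor p)⁻¹ := by
    rw [velocity, smul_dotProduct, smul_eq_mul]
    field_simp
    linarith
  have hleft : (frame N (N • velocity p) e)ᵀ * minkowski n * lorentzBoost p =
      Matrix.fromBlocks ((-(N * (gammaFactor p)⁻¹)) • 1) 0
        (Matrix.replicateCol Unit (eᵀ *ᵥ p)) (eᵀ * spatialBoost p) := by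
    rw [lorentzBoost, minkowski_eq, frame, Matrix.fromBlocks_transpose,
      Matrix.fromBlocks_multiply, Matrix.fromBlocks_multiply]
    congr 1
    · ext i j
      simp [replicateRow_mul_replicateCol_eq, h2]
      ring
    · simp [replicateRow_mul, h1]
    · simp [mul_replicateCol]
    · simp
  rw [hleft, frame, Matrix.fromBlocks_multiply]
  congr 1
  · simp [smul_smul]
    ring_nf
  · simp
  · ext i j
    simp [mul_replicateCol, Matrix.mulVec_add, Matrix.mulVec_smul]
  · simp

/-- The metric of a boosted frame has positive definite symmetric part after its time row is
reversed. -/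
theorem minkowski_mul_frame_metric_pos {N : ℝ} (hN : N ≠ 0) {e : SpMat n} (he : IsUnit e.det)
    (x : STIdx n → ℝ) (hx : x ≠ 0) :
    0 < x ⬝ᵥ (minkowski n * ((frame N (N • velocity p) e)ᵀ * minkowski n *
      frame N (N • velocity p) e)) *ᵥ x := by
  have h0 := gammaFactor_sq p
  have hpos := gammaFactor_pos p
  obtain ⟨a, y, rfl⟩ : ∃ (a : ℝ) (y : Fin n → ℝ), x = Sum.elim (fun _ => a) y :=
    ⟨x (.inl ()), x ∘ .inr, by ext (i | i) <;> rfl⟩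
  have hηv : ∀ (b : ℝ) (z : Fin n → ℝ), minkowski n *ᵥ Sum.elim (fun _ => b) z =
      Sum.elim (fun _ => -b) z := by
    intro b z
    rw [minkowski, Matrix.fromBlocks_mulVec]
    ext (i | i) <;> simp [Matrix.neg_mulVec]
  have hFv : ∀ (b : ℝ) (z : Fin n → ℝ), frame N (N • velocity p) e *ᵥ Sum.elim (fun _ => b) z =
      Sum.elim (fun _ => N * b) ((b * N) • velocity p + e *ᵥ z) := by
    intro b z
    rw [frame, Matrix.fromBlocks_mulVec]
    ext (i | i)
    · simp [Matrix.smul_mulVec]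
    · simp [Matrix.mulVec, dotProduct]
      ring
  have hv : velocity p ⬝ᵥ velocity p = 1 - ((gammaFactor p)⁻¹) ^ 2 := by
    rw [velocity, smul_dotProduct, dotProduct_smul, smul_eq_mul, smul_eq_mul]
    field_simp
    linarith
  -- Reversing the time row makes the mixed blocks opposite, so they drop out of the quadratic form;
  -- the time entry is `N² (1 - |v|²) = N² λ⁻²`.
  have key : Sum.elim (fun _ => a) y ⬝ᵥ (minkowski n * ((frame N (N • velocity p) e)ᵀ *
      minkowski n * frame N (N • velocity p) e)) *ᵥ Sum.elim (fun _ => a) y =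
      (N * (gammaFactor p)⁻¹ * a) ^ 2 + (e *ᵥ y) ⬝ᵥ (e *ᵥ y) := by
    simp only [← Matrix.mulVec_mulVec]
    rw [dotProduct_mulVec_comm minkowski_transpose]
    rw [← dotProduct_comm, hηv]
    rw [Matrix.dotProduct_mulVec, Matrix.vecMul_transpose, hFv, hFv, hηv]
    rw [sumElim_dotProduct_sumElim]
    simp only [dotProduct_add, add_dotProduct, smul_dotProduct, dotProduct_smul, hv, smul_eq_mul,
      dotProduct_comm (e *ᵥ y) (velocity p)]
    simp [dotProduct]
    ring
  rw [key]
  by_cases hy : y = 0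
  · subst hy
    have ha : a ≠ 0 := by
      rintro rfl
      exact hx (by ext (i | i) <;> rfl)
    simp only [Matrix.mulVec_zero, dotProduct_zero, add_zero]
    positivity
  · have : e *ᵥ y ≠ 0 := fun h => hy (Matrix.mulVec_injective_of_isUnit
      ((Matrix.isUnit_iff_isUnit_det _).2 he) (by simpa using h))
    have := dotProduct_self_pos this
    positivity

/-- Polar decomposition of a Lorentz transformation. -/
theorem exists_eq_lorentzBoost_mul {T : STMat n} (hT : Tᵀ * minkowski n * T = minkowski n) :
    ∃ (ε : ℝ) (p : Fin n → ℝ) (R : SpMat n), (ε = 1 ∨ ε = -1) ∧ R * Rᵀ = 1 ∧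
      T = lorentzBoost p * Matrix.fromBlocks (ε • 1) 0 0 R := by
  have hT' : T * minkowski n * Tᵀ = minkowski n := by
    have h1 : (minkowski n * Tᵀ * minkowski n) * T = 1 := by
      rw [mul_assoc (minkowski n), mul_assoc (minkowski n), hT, minkowski_mul_self]
    have h2 := mul_eq_one_comm.1 h1
    calc T * minkowski n * Tᵀ = T * (minkowski n * Tᵀ * minkowski n) * minkowski n := by
          simp only [mul_assoc, minkowski_mul_self, mul_one]
      _ = minkowski n := by rw [h2, one_mul]
  have hcomp := fromBlocks_components T
  set a := T (.inl ()) (.inl ())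
  set b : Fin n → ℝ := fun j => T (.inl ()) (.inr j)
  set c : Fin n → ℝ := fun i => T (.inr i) (.inl ())
  set D := T.toBlocks₂₂
  rw [hcomp, minkowski_eq, Matrix.fromBlocks_transpose, Matrix.fromBlocks_multiply,
    Matrix.fromBlocks_multiply, Matrix.fromBlocks_inj] at hT hT'
  have hac : a ^ 2 = 1 + c ⬝ᵥ c := by
    have := congrFun (congrFun hT.1 ()) ()
    simp [replicateRow_mul_replicateCol_eq] at this
    linarith
  have hcD : c ᵥ* D = a • b := by
    have h1 := hT.2.1
    ext j
    have := congrFun (congrFun h1 ()) j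
    simp [replicateRow_mul] at this
    simp
    linarith
  have hDD : D * Dᵀ = 1 + Matrix.vecMulVec c c := by
    have := hT'.2.2.2
    simp [replicateCol_mul_replicateRow_eq] at this
    rw [← this]; abel
  obtain ⟨ε, hε, hεa⟩ : ∃ ε : ℝ, (ε = 1 ∨ ε = -1) ∧ |a| = ε * a := by
    rcases le_total 0 a with h | h
    · exact ⟨1, .inl rfl, by rw [abs_of_nonneg h, one_mul]⟩
    · exact ⟨-1, .inr rfl, by rw [abs_of_nonpos h]; ring⟩
  have hεε : ε * ε = 1 := by rcases hε with rfl | rfl <;> norm_num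
  -- The time column of the desired product is `(ε λ, ε p)`, which must equal `(a, c)`; since `λ >
  -- 0`, `ε` is a sign of `a`.
  set p := ε • c with hp
  have hpp : p ⬝ᵥ p = c ⬝ᵥ c := by
    rw [hp, smul_dotProduct, dotProduct_smul, smul_smul, hεε, one_smul]
  have hvec : Matrix.vecMulVec p p = Matrix.vecMulVec c c := by
    rw [hp, Matrix.smul_vecMulVec, Matrix.vecMulVec_smul, smul_smul, hεε, one_smul]
  have hg : gammaFactor p = ε * a := by
    rw [gammaFactor, hpp, ← hac, Real.sqrt_sq_eq_abs, hεa]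
  have hu := isUnit_det_of_posDef (spatialBoost_posDef p)
  have hpos := gammaFactor_pos p
  -- The rotation is orthogonal because `D Dᵀ = 1 + p pᵀ` is the square of the spatial boost.
  refine ⟨ε, p, (spatialBoost p)⁻¹ * D, hε, ?_, ?_⟩
  · rw [Matrix.transpose_mul, Matrix.transpose_nonsing_inv, spatialBoost_transpose,
      mul_assoc, ← mul_assoc D, hDD, ← hvec, ← spatialBoost_mul_self, mul_assoc,
      Matrix.mul_nonsing_inv _ hu, mul_one, Matrix.nonsing_inv_mul _ hu]
  · rw [hcomp, lorentzBoost, Matrix.fromBlocks_multiply]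
    congr 1
    · rw [hg]
      have h1 : a = ε * (ε * a) := by rw [← mul_assoc, hεε, one_mul]
      simpa [smul_smul] using h1
    · have h1 : p ᵥ* (spatialBoost p)⁻¹ = (gammaFactor p)⁻¹ • p := by
        rw [← Matrix.mulVec_transpose, Matrix.transpose_nonsing_inv, spatialBoost_transpose]
        have := congrArg ((spatialBoost p)⁻¹ *ᵥ ·) (spatialBoost_mulVec_velocity p)
        simp only [Matrix.mulVec_mulVec, Matrix.nonsing_inv_mul _ hu, Matrix.one_mulVec] at this
        rw [← this, velocity]
      have h2 : p ᵥ* ((spatialBoost p)⁻¹ * D) = b := by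
        rw [← Matrix.vecMul_vecMul, h1, Matrix.smul_vecMul]
        rw [hp, Matrix.smul_vecMul, hcD, smul_smul, smul_smul, ← hp, mul_assoc, ← hg,
          inv_mul_cancel₀ hpos.ne', one_smul]
      simp [replicateRow_mul, h2]
    · simp [hp, smul_smul, hεε]
    · simp [Matrix.mul_nonsing_inv_cancel_left _ _ hu]

end Boost

/-! ### Time reversal and the mean metric -/

section MeanMetric

variable {n : ℕ}

theorem posDef_fromBlocks_iff {a : ℝ} {χ : SpMat n} :
    (Matrix.fromBlocks (a • (1 : Matrix Unit Unit ℝ)) 0 0 χ).PosDef ↔ 0 < a ∧ χ.PosDef := by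
  refine ⟨fun h => ⟨?_, ?_⟩, fun ⟨ha, hχ⟩ => ?_⟩
  · simpa using h.diag_pos (i := Sum.inl ())
  · exact h.submatrix Sum.inr_injective
  · obtain ⟨hχs, hχp⟩ := posDef_iff.1 hχ
    refine posDef_iff.2 ⟨by simp [Matrix.fromBlocks_transpose, hχs], fun x hx => ?_⟩
    obtain ⟨b, y, rfl⟩ : ∃ (b : ℝ) (y : Fin n → ℝ), x = Sum.elim (fun _ => b) y :=
      ⟨x (.inl ()), x ∘ .inr, by ext (i | i) <;> rfl⟩
    have key : Sum.elim (fun _ => b) y ⬝ᵥ Matrix.fromBlocks (a • (1 : Matrix Unit Unit ℝ)) 0 0 χ *ᵥ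
        Sum.elim (fun _ => b) y = a * b ^ 2 + y ⬝ᵥ χ *ᵥ y := by
      rw [Matrix.fromBlocks_mulVec, sumElim_dotProduct_sumElim]
      simp [Matrix.smul_mulVec, Function.comp_def, dotProduct]
      ring
    rw [key]
    by_cases hy : y = 0
    · subst hy
      have hb : b ≠ 0 := by
        rintro rfl
        exact hx (by ext (i | i) <;> rfl)
      simp only [Matrix.mulVec_zero, dotProduct_zero, add_zero]
      positivity
    · have := hχp y hy
      positivity

theorem minkowski_mul_fromBlocks (a : ℝ) (χ : SpMat n) :
    minkowski n * Matrix.fromBlocks (a • 1) 0 0 χ = Matrix.fromBlocks ((-a) • 1) 0 0 χ := by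
  simp [minkowski, Matrix.fromBlocks_multiply]

/-- Supplies the positivity hypothesis on `A` in both directions of Lyapunov's theorem. -/
theorem frame_metric_sheared_pos (p q : Fin n → ℝ) {N : ℝ} (hN : N ≠ 0) {e : SpMat n}
    (he : IsUnit e.det) (x : STIdx n → ℝ) (hx : x ≠ 0) :
    0 < x ⬝ᵥ ((shear q)ᵀ * (minkowski n * ((frame N (N • velocity p) e)ᵀ * minkowski n *
      frame N (N • velocity p) e)) * shear q) *ᵥ x := by
  have hne : shear q *ᵥ x ≠ 0 := fun h => hx (Matrix.mulVec_injective_of_isUnit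
    ((Matrix.isUnit_iff_isUnit_det _).2 (isUnit_det_shear q)) (by simpa using h))
  have := minkowski_mul_frame_metric_pos p hN he _ hne
  rwa [mul_assoc, ← Matrix.mulVec_mulVec, ← Matrix.mulVec_mulVec, Matrix.dotProduct_mulVec,
    Matrix.vecMul_transpose]

/-- Reversal of the time row on both sides of `g S = h`, in the frame with shift `q`. -/
theorem reverse_time_row {q : Fin n → ℝ} {g' h' S : STMat n}
    (h : (shear q)ᵀ * g' * shear q * S = (shear q)ᵀ * h' * shear q) :
    (shear q)ᵀ * (minkowski n * g') * shear q * S = (shear q)ᵀ * (minkowski n * h') * shear q := by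
  have hu : IsUnit (shear q)ᵀ := by
    rw [Matrix.isUnit_iff_isUnit_det, Matrix.det_transpose]
    exact isUnit_det_shear q
  have h1 : g' * shear q * S = h' * shear q := by
    apply hu.mul_left_cancel
    simpa only [mul_assoc] using h
  simp only [mul_assoc] at h1 ⊢
  rw [h1]

theorem inv_frame_metric {E : STMat n} (hE : IsUnit E.det) :
    E * (Eᵀ * minkowski n * E)⁻¹ * Eᵀ = minkowski n := by
  have hEt : IsUnit (Eᵀ).det := by rwa [Matrix.det_transpose]
  have hη : (minkowski n)⁻¹ = minkowski n := Matrix.inv_eq_left_inv minkowski_mul_self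
  rw [Matrix.mul_inv_rev, Matrix.mul_inv_rev, hη, ← mul_assoc, ← mul_assoc,
    Matrix.mul_nonsing_inv _ hE, one_mul, mul_assoc, Matrix.nonsing_inv_mul _ hEt, mul_one]

/-- Symmetry replaces the left factor by `Lᵀ Λ η E`; then `E g⁻¹ Eᵀ = η` and `Λ η Λ = η` collapse
the product. -/
theorem mean_mul_inv_mul_mean {E L : STMat n} (hE : IsUnit E.det) {p : Fin n → ℝ}
    (hs : (Eᵀ * minkowski n * lorentzBoost p * L)ᵀ = Eᵀ * minkowski n * lorentzBoost p * L) :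
    (Eᵀ * minkowski n * lorentzBoost p * L) * (Eᵀ * minkowski n * E)⁻¹ *
      (Eᵀ * minkowski n * lorentzBoost p * L) = Lᵀ * minkowski n * L := by
  nth_rw 1 [← hs]
  simp only [Matrix.transpose_mul, Matrix.transpose_transpose, minkowski_transpose,
    lorentzBoost_transpose]
  calc _ = Lᵀ * (lorentzBoost p * (minkowski n * (E * (Eᵀ * minkowski n * E)⁻¹ * Eᵀ) *
        minkowski n) * lorentzBoost p) * L := by simp only [mul_assoc]
    _ = _ := by
      rw [inv_frame_metric hE, minkowski_mul_self, one_mul, lorentzBoost_mul_minkowski_mul]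

/-- If `S` is a principal square root of `g⁻¹ f` with `g` and `f` symmetric, then `g S` is
symmetric. -/
theorem IsPrincipalSqrt.transpose_mul_eq {ι : Type*} [Fintype ι] [DecidableEq ι]
    {g f S : Matrix ι ι ℝ} (hg : gᵀ = g) (hf : fᵀ = f) (hu : IsUnit g.det)
    (hS : IsPrincipalSqrt (g⁻¹ * f) S) : (g * S)ᵀ = g * S := by
  -- The `g`-adjoint of `S` is again a principal root, so uniqueness makes `S` self-adjoint for `g`.
  have hY : IsPrincipalSqrt (g⁻¹ * f) (g⁻¹ * (Sᵀ * g)) := by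
    constructor
    · have h1 : Sᵀ * Sᵀ = f * g⁻¹ := by
        rw [← Matrix.transpose_mul, hS.1, Matrix.transpose_mul, Matrix.transpose_nonsing_inv, hg,
          hf]
      calc _ = g⁻¹ * (Sᵀ * (g * g⁻¹) * Sᵀ) * g := by simp only [mul_assoc]
        _ = g⁻¹ * f * (g⁻¹ * g) := by
          rw [Matrix.mul_nonsing_inv _ hu, mul_one, h1]; simp only [mul_assoc]
        _ = _ := by rw [Matrix.nonsing_inv_mul _ hu, mul_one]
    · have hc : (g⁻¹ * (Sᵀ * g)).charpoly = S.charpoly := by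
        rw [Matrix.charpoly_mul_comm, mul_assoc, Matrix.mul_nonsing_inv _ hu, mul_one,
          Matrix.charpoly_transpose]
      intro μ hμ
      refine hS.2 μ ?_
      rw [Matrix.mem_spectrum_iff_isRoot_charpoly, Matrix.charpoly_map] at hμ ⊢
      rwa [hc] at hμ
  have := hS.unique hY
  rw [Matrix.transpose_mul, hg]
  nth_rw 2 [this]
  rw [Matrix.mul_nonsing_inv_cancel_left _ _ hu]

end MeanMetric

/-! ### Validity of the parametrization -/

namespace Params

variable {n : ℕ} (P : Params n)

theorem boost_eq : P.boost = spatialBoost P.p :=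
  principalSqrt_eq (isPrincipalSqrt_of_posDef (spatialBoost_posDef _) (spatialBoost_mul_self _))

theorem isUnit_det_boost : IsUnit P.boost.det :=
  P.boost_eq ▸ isUnit_det_of_posDef (spatialBoost_posDef _)

theorem isUnit_det_Rbar : IsUnit P.Rbar.det := by
  rw [Rbar, Matrix.det_mul, Matrix.det_mul, Matrix.det_transpose, Matrix.det_transpose]
  exact ((Matrix.isUnit_nonsing_inv_det _ P.mbar_unit).mul P.e_unit).mul P.isUnit_det_boost

theorem exists_posDef_principalSqrt_Rbar :
    ∃ Q : SpMat n, Q.PosDef ∧ Q * Q = P.Rbarᵀ * P.Rbar ∧ P.Rhat = Q * P.Rbar⁻¹ := by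
  obtain ⟨Q, hQ, hQQ⟩ := exists_posDef_mul_self (posDef_transpose_mul_self P.isUnit_det_Rbar)
  exact ⟨Q, hQ, hQQ, by rw [Rhat, principalSqrt_eq (isPrincipalSqrt_of_posDef hQ hQQ)]⟩

theorem Rhat_transpose_mul_self : P.Rhatᵀ * P.Rhat = 1 := by
  obtain ⟨Q, hQ, hQQ, hR⟩ := P.exists_posDef_principalSqrt_Rbar
  have hu := P.isUnit_det_Rbar
  have hut : IsUnit (P.Rbarᵀ).det := by rwa [Matrix.det_transpose]
  rw [hR, Matrix.transpose_mul, (posDef_iff.1 hQ).1, Matrix.transpose_nonsing_inv, mul_assoc,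
    ← mul_assoc Q, hQQ, mul_assoc, Matrix.mul_nonsing_inv _ hu, mul_one,
    Matrix.nonsing_inv_mul _ hut]

theorem isUnit_det_m : IsUnit P.m.det := by
  rw [m, Matrix.det_mul]
  exact (Matrix.isUnit_det_of_left_inverse P.Rhat_transpose_mul_self).mul P.mbar_unit

theorem φ_eq : P.φ = P.mᵀ * P.m := by
  rw [m, Matrix.transpose_mul, mul_assoc, ← mul_assoc P.Rhatᵀ, Rhat_transpose_mul_self, one_mul, φ]

theorem mbar_transpose_mul_Rbar : P.mbarᵀ * P.Rbar = P.eᵀ * P.boost := by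
  rw [Rbar, ← mul_assoc, ← mul_assoc, ← Matrix.transpose_mul,
    Matrix.nonsing_inv_mul _ P.mbar_unit, Matrix.transpose_one, one_mul]

/-- With `Q = (R̄ᵀ R̄)^{1/2}`, the identity `Q R̄⁻¹ = Q⁻¹ R̄ᵀ` exhibits `χ` as congruent to `Q⁻¹`.
-/
theorem χ_posDef : P.χ.PosDef := by
  obtain ⟨Q, hQ, hQQ, hR⟩ := P.exists_posDef_principalSqrt_Rbar
  have hu := P.isUnit_det_Rbar
  have hQu := isUnit_det_of_posDef hQ
  have hQR : Q * P.Rbar⁻¹ = Q⁻¹ * P.Rbarᵀ := by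
    calc Q * P.Rbar⁻¹ = Q⁻¹ * (Q * Q) * P.Rbar⁻¹ := by
          rw [Matrix.nonsing_inv_mul_cancel_left _ _ hQu]
      _ = _ := by rw [hQQ, mul_assoc, mul_assoc, Matrix.mul_nonsing_inv _ hu, mul_one]
  have hχ : P.χ = (P.Rbarᵀ * P.mbar)ᵀ * Q⁻¹ * (P.Rbarᵀ * P.mbar) := by
    rw [χ, m, hR, hQR, ← mbar_transpose_mul_Rbar, Matrix.transpose_mul, Matrix.transpose_transpose]
    simp only [mul_assoc]
  rw [hχ]
  refine posDef_transpose_mul_mul hQ.inv ?_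
  rw [Matrix.det_mul, Matrix.det_transpose]
  exact hu.mul P.mbar_unit

theorem H_pos : 0 < P.H :=
  Real.sqrt_pos.2 (mul_pos (mul_pos P.N_pos P.M_pos) (inv_pos.2 (gammaFactor_pos P.p)))

theorem H_sq : P.H ^ 2 = P.N * P.M * (gammaFactor P.p)⁻¹ :=
  Real.sq_sqrt (mul_pos (mul_pos P.N_pos P.M_pos) (inv_pos.2 (gammaFactor_pos P.p))).le

/-- The coframe of `g`. -/
def coframeG : STMat n := frame P.N (P.N • velocity P.p) P.e * shear P.q

/-- The coframe of `f`. -/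
def coframeF : STMat n := frame P.M (-(P.M • velocity P.p)) P.m * shear P.q

theorem isUnit_det_coframeG : IsUnit P.coframeG.det :=
  isUnit_det_mul_shear (isUnit_det_frame P.N_pos.ne' _ P.e_unit) _

theorem g_eq : P.g = P.coframeGᵀ * minkowski n * P.coframeG := by
  rw [g, γ, admMetric_eq, shiftG, frame_mul_shear_add, Matrix.mulVec_smul, Matrix.mulVec_mulVec,
    Matrix.mul_nonsing_inv _ P.e_unit, Matrix.one_mulVec]
  rfl

theorem f_eq : P.f = P.coframeFᵀ * minkowski n * P.coframeF := by
  rw [f, φ_eq, admMetric_eq, shiftF, sub_eq_add_neg, frame_mul_shear_add, Matrix.mulVec_neg,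
    Matrix.mulVec_smul, Matrix.mulVec_mulVec, Matrix.mul_nonsing_inv _ P.isUnit_det_m,
    Matrix.one_mulVec]
  rfl

/-- The legs `-M v` cancel the mixed block, since the spatial boost sends `M v` to `M p`. -/
theorem h_eq : P.h = P.coframeGᵀ * minkowski n * lorentzBoost P.p * P.coframeF := by
  have h1 : (frame P.N (P.N • velocity P.p) P.e)ᵀ * minkowski n * lorentzBoost P.p *
      frame P.M (-(P.M • velocity P.p)) P.m = Matrix.fromBlocks ((-P.H ^ 2) • 1) 0 0 P.χ := by
    rw [frame_minkowski_boost_frame, H_sq, χ, boost_eq, Matrix.mulVec_neg, Matrix.mulVec_smul,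
      spatialBoost_mulVec_velocity, add_neg_cancel, Matrix.mulVec_zero, Matrix.replicateCol_zero]
  rw [h, admMetric, ← h1, coframeG, coframeF, Matrix.transpose_mul]
  simp only [mul_assoc]

theorem isLorentzian_g : IsLorentzian P.g := isLorentzian_admMetric P.N_pos.ne' _ P.e_unit

theorem isLorentzian_f : IsLorentzian P.f := isLorentzian_admMetric P.M_pos.ne' _ P.mbar_unit

theorem isLorentzian_h : IsLorentzian P.h := by
  obtain ⟨X, hX, hXX⟩ := exists_posDef_mul_self P.χ_posDef
  have : P.χ = Xᵀ * X := by rw [(posDef_iff.1 hX).1, hXX]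
  rw [h, this]
  exact isLorentzian_admMetric P.H_pos.ne' _ (isUnit_det_of_posDef hX)

theorem spacelikeSlice_g : SpacelikeSlice P.g := by
  rw [SpacelikeSlice, g, toBlocks₂₂_admMetric]
  exact posDef_transpose_mul_self P.e_unit

theorem spacelikeSlice_f : SpacelikeSlice P.f := by
  rw [SpacelikeSlice, f, toBlocks₂₂_admMetric]
  exact posDef_transpose_mul_self P.mbar_unit

theorem spacelikeSlice_h : SpacelikeSlice P.h := by
  rw [SpacelikeSlice, h, toBlocks₂₂_admMetric]
  exact P.χ_posDef

theorem h_mul_inv_mul_h : P.h * P.g⁻¹ * P.h = P.f := by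
  have hs := P.isLorentzian_h.transpose_eq
  rw [g_eq, f_eq]
  rw [h_eq] at hs ⊢
  exact mean_mul_inv_mul_mean P.isUnit_det_coframeG hs

theorem S_eq : P.S = P.h⁻¹ * P.f := by
  rw [← h_mul_inv_mul_h, mul_assoc,
    Matrix.nonsing_inv_mul_cancel_left _ _ P.isLorentzian_h.isUnit_det, S]

theorem g_mul_S : P.g * P.S = P.h :=
  Matrix.mul_nonsing_inv_cancel_left _ _ P.isLorentzian_g.isUnit_det

theorem isPrincipalSqrt_S : IsPrincipalSqrt (P.g⁻¹ * P.f) P.S := by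
  refine ⟨by rw [← h_mul_inv_mul_h, S]; simp only [mul_assoc], ?_⟩
  have h1 := P.g_mul_S
  rw [g_eq, coframeG, Matrix.transpose_mul, h, admMetric] at h1
  have h2 := reverse_time_row (q := P.q) (S := P.S) (g' := (frame P.N (P.N • velocity P.p) P.e)ᵀ *
    minkowski n * frame P.N (P.N • velocity P.p) P.e) (by simpa only [mul_assoc] using h1)
  refine spectrum_re_pos_of_mul_eq (frame_metric_sheared_pos P.p P.q P.N_pos.ne' P.e_unit) ?_ h2
  rw [minkowski_mul_fromBlocks, neg_neg]
  exact posDef_transpose_mul_mul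
    (posDef_fromBlocks_iff.2 ⟨pow_pos P.H_pos 2, P.χ_posDef⟩) (isUnit_det_shear _)

theorem h_eq_geomMean : P.h = geomMean P.g P.f := by
  rw [geomMean, principalSqrt_eq P.isPrincipalSqrt_S, g_mul_S]

/-- The rotation is determined by the positivity of the mean spatial metric. -/
theorem Rhat_eq_of_posDef {R : SpMat n} (hR : R * Rᵀ = 1)
    (hχ : (P.eᵀ * P.boost * (R * P.mbar)).PosDef) : P.Rhat = R := by
  have hR' : Rᵀ * R = 1 := mul_eq_one_comm.1 hR
  have hmu := Matrix.mul_nonsing_inv _ P.mbar_unit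
  have hQ : (P.Rbar * R).PosDef := by
    have h1 := posDef_transpose_mul_mul hχ (Matrix.isUnit_nonsing_inv_det _ P.mbar_unit)
    rw [← mbar_transpose_mul_Rbar] at h1
    have h2 : (P.mbar⁻¹)ᵀ * P.mbarᵀ = 1 := by
      rw [← Matrix.transpose_mul, hmu, Matrix.transpose_one]
    have h3 : (P.mbar⁻¹)ᵀ * (P.mbarᵀ * P.Rbar * (R * P.mbar)) * P.mbar⁻¹ = P.Rbar * R := by
      calc _ = ((P.mbar⁻¹)ᵀ * P.mbarᵀ) * (P.Rbar * R) * (P.mbar * P.mbar⁻¹) := by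
            simp only [mul_assoc]
        _ = _ := by rw [h2, hmu, one_mul, mul_one]
    rwa [h3] at h1
  have hRR : P.Rbarᵀ = R * (P.Rbar * R) := by
    rw [← (posDef_iff.1 hQ).1, Matrix.transpose_mul, ← mul_assoc, hR, one_mul]
  -- `R R̄ = R (R̄ R) Rᵀ` is positive definite, and `R̄ᵀ = R R̄ R` makes its square `R̄ᵀ R̄`.
  have hsq : IsPrincipalSqrt (P.Rbarᵀ * P.Rbar) (R * P.Rbar) := by
    refine isPrincipalSqrt_of_posDef ?_ ?_
    · have := posDef_transpose_mul_mul hQ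
        (Matrix.isUnit_det_of_left_inverse (B := R) (A := Rᵀ) hR)
      rw [Matrix.transpose_transpose, mul_assoc, mul_assoc, hR, mul_one] at this
      exact this
    · rw [hRR]
      simp only [mul_assoc]
  rw [Rhat, principalSqrt_eq hsq, mul_assoc, Matrix.mul_nonsing_inv _ P.isUnit_det_Rbar, mul_one]

end Params

/-! ### Exhaustiveness of the parametrization -/

/-- A principal square root of `g⁻¹ f` is produced by parameters with prescribed vielbeins. -/
theorem exists_params {n : ℕ} {g f S : STMat n} (hg : IsLorentzian g) (hgs : SpacelikeSlice g)
    (hf : IsLorentzian f) (hfs : SpacelikeSlice f) (hS : IsPrincipalSqrt (g⁻¹ * f) S)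
    {e mbar : SpMat n} (he : eᵀ * e = g.toBlocks₂₂) (hm : mbarᵀ * mbar = f.toBlocks₂₂) :
    ∃ P : Params n, P.e = e ∧ P.mbar = mbar ∧ P.g = g ∧ P.f = f ∧ P.S = S := by
  have heu : IsUnit e.det := isUnit_det_of_transpose_mul_self (he ▸ hgs)
  have hmu : IsUnit mbar.det := isUnit_det_of_transpose_mul_self (hm ▸ hfs)
  obtain ⟨N, hN, ν, hgN⟩ := hg.exists_eq_admMetric hgs
  obtain ⟨M, hM, ν', hfM⟩ := hf.exists_eq_admMetric hfs
  rw [← he] at hgN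
  rw [← hm] at hfM
  set E := frame N 0 e * shear ν with hE
  set L := frame M 0 mbar * shear ν' with hL
  have hgE : g = Eᵀ * minkowski n * E := hgN.trans (admMetric_eq _ _ _)
  have hfL : f = Lᵀ * minkowski n * L := hfM.trans (admMetric_eq _ _ _)
  have hLu : IsUnit L.det := isUnit_det_mul_shear (isUnit_det_frame hM.ne' 0 hmu) _
  have hsym : (g * S)ᵀ = g * S := hS.transpose_mul_eq hg.transpose_eq hf.transpose_eq hg.isUnit_det
  have hT : (E * S * L⁻¹)ᵀ * minkowski n * (E * S * L⁻¹) = minkowski n := by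
    have h1 : Sᵀ * g * S = f := by
      have : Sᵀ * g = g * S := by rw [← hsym, Matrix.transpose_mul, hg.transpose_eq]
      rw [this, mul_assoc, hS.1, Matrix.mul_nonsing_inv_cancel_left _ _ hg.isUnit_det]
    have h2 : (L⁻¹)ᵀ * Lᵀ = 1 := by
      rw [← Matrix.transpose_mul, Matrix.mul_nonsing_inv _ hLu, Matrix.transpose_one]
    calc _ = (L⁻¹)ᵀ * (Sᵀ * (Eᵀ * minkowski n * E) * S) * L⁻¹ := by
          simp only [Matrix.transpose_mul, mul_assoc]
      _ = ((L⁻¹)ᵀ * Lᵀ) * minkowski n * (L * L⁻¹) := by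
          rw [← hgE, h1, hfL]; simp only [mul_assoc]
      _ = _ := by rw [h2, Matrix.mul_nonsing_inv _ hLu, one_mul, mul_one]
  obtain ⟨ε, p, R, hε, hR, hTp⟩ := exists_eq_lorentzBoost_mul hT
  set m := R * mbar with hmdef
  have hmu' : IsUnit m.det := by
    rw [hmdef, Matrix.det_mul]
    exact (Matrix.isUnit_det_of_right_inverse hR).mul hmu
  -- Forced by the shift formula for `g`; it gives the coframe `E` the spatial legs `N v`.
  set q := ν - N • (e⁻¹ *ᵥ velocity p) with hq
  set w := ν' - q with hw
  have hEq : E = frame N (N • velocity p) e * shear q := by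
    have : ν = q + N • (e⁻¹ *ᵥ velocity p) := by rw [hq, sub_add_cancel]
    rw [hE, this, frame_mul_shear_add, Matrix.mulVec_smul, Matrix.mulVec_mulVec,
      Matrix.mul_nonsing_inv _ heu, Matrix.one_mulVec]
  have hLq : Matrix.fromBlocks (ε • 1) 0 0 R * L = frame (ε * M) (m *ᵥ w) m * shear q := by
    have h1 : Matrix.fromBlocks (ε • 1) 0 0 R * frame M 0 mbar = frame (ε * M) 0 m := by
      simp [frame, Matrix.fromBlocks_multiply, smul_smul, hmdef, mul_comm]
    have : ν' = q + w := by rw [hw, add_sub_cancel]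
    rw [hL, ← mul_assoc, h1, this, frame_mul_shear_add]
  have hES : E * S = lorentzBoost p * (frame (ε * M) (m *ᵥ w) m * shear q) := by
    rw [← hLq, ← mul_assoc, ← hTp, Matrix.nonsing_inv_mul_cancel_right _ _ hLu]
  have hgS : g * S = (shear q)ᵀ * Matrix.fromBlocks ((-(N * (ε * M) * (gammaFactor p)⁻¹)) • 1) 0
      (Matrix.replicateCol Unit (eᵀ *ᵥ ((ε * M) • p + spatialBoost p *ᵥ (m *ᵥ w))))
      (eᵀ * spatialBoost p * m) * shear q := by
    rw [← frame_minkowski_boost_frame, hgE, mul_assoc, hES, hEq, Matrix.transpose_mul]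
    simp only [mul_assoc]
  have hqu := isUnit_det_shear q
  have hsym' := hsym
  rw [hgS] at hsym'
  have hinner : ∀ {X : STMat n}, ((shear q)ᵀ * X * shear q)ᵀ = (shear q)ᵀ * X * shear q →
      Xᵀ = X := by
    intro X hX
    rw [Matrix.transpose_mul, Matrix.transpose_mul, Matrix.transpose_transpose, mul_assoc] at hX
    have hqt : IsUnit (shear q)ᵀ := by
      rw [Matrix.isUnit_iff_isUnit_det, Matrix.det_transpose]; exact hqu
    have h1 := hqt.mul_left_cancel hX
    exact ((Matrix.isUnit_iff_isUnit_det _).2 hqu).mul_right_cancel h1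
  -- The upper right block is zero, so symmetry kills the lower left column and makes the spatial
  -- block symmetric.
  have hblocks := hinner hsym'
  rw [Matrix.fromBlocks_transpose, Matrix.fromBlocks_inj] at hblocks
  have hcol : Matrix.replicateCol Unit
      (eᵀ *ᵥ ((ε * M) • p + spatialBoost p *ᵥ (m *ᵥ w))) = 0 := by
    rw [← hblocks.2.2.1, Matrix.transpose_zero]
  have hχs := hblocks.2.2.2
  rw [hcol] at hgS
  have hrev := reverse_time_row (q := q) (S := S) (g' := (frame N (N • velocity p) e)ᵀ *
    minkowski n * frame N (N • velocity p) e) (h' := Matrix.fromBlocks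
      ((-(N * (ε * M) * (gammaFactor p)⁻¹)) • 1) 0 0 (eᵀ * spatialBoost p * m)) (by
    rw [← hgS, hgE, hEq, Matrix.transpose_mul]
    simp only [mul_assoc])
  rw [minkowski_mul_fromBlocks, neg_neg] at hrev
  -- Here principality enters through the spectrum: it rules out `ε = -1` and makes the spatial
  -- block positive definite, which identifies `R` with `P.Rhat`.
  have hB := posDef_of_spectrum_re_pos (frame_metric_sheared_pos p q hN.ne' heu) (by
    rw [Matrix.transpose_mul, Matrix.transpose_mul, Matrix.transpose_transpose,
      Matrix.fromBlocks_transpose, hχs]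
    simp [mul_assoc]) hrev hS.2
  have hB' : (Matrix.fromBlocks ((N * (ε * M) * (gammaFactor p)⁻¹) • (1 : Matrix Unit Unit ℝ)) 0 0
      (eᵀ * spatialBoost p * m)).PosDef := by
    have h1 := posDef_transpose_mul_mul hB (Matrix.isUnit_nonsing_inv_det _ hqu)
    have h2 : ((shear q)⁻¹)ᵀ * (shear q)ᵀ = 1 := by
      rw [← Matrix.transpose_mul, Matrix.mul_nonsing_inv _ hqu, Matrix.transpose_one]
    rwa [mul_assoc (shear q)ᵀ, ← mul_assoc _ (shear q)ᵀ, h2, one_mul,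
      Matrix.mul_nonsing_inv_cancel_right _ _ hqu] at h1
  obtain ⟨hpos, hχ⟩ := posDef_fromBlocks_iff.1 hB'
  have hγ := gammaFactor_pos p
  have hε1 : ε = 1 := by
    rcases hε with h | h
    · exact h
    · subst h
      have : 0 < N * M * (gammaFactor p)⁻¹ := by positivity
      linarith
  subst hε1
  have hw' : w = -(M • (m⁻¹ *ᵥ velocity p)) := by
    have hbu := isUnit_det_of_posDef (spatialBoost_posDef p)
    have h1 : eᵀ *ᵥ ((1 * M) • p + spatialBoost p *ᵥ (m *ᵥ w)) = eᵀ *ᵥ 0 := by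
      rw [Matrix.mulVec_zero]
      exact (Matrix.replicateCol_eq_zero _).1 hcol
    have h2 := Matrix.mulVec_injective_of_isUnit
      ((Matrix.isUnit_iff_isUnit_det _).2 (by rwa [Matrix.det_transpose])) h1
    have h3 : spatialBoost p *ᵥ (m *ᵥ w) = spatialBoost p *ᵥ (-(M • velocity p)) := by
      rw [Matrix.mulVec_neg, Matrix.mulVec_smul, spatialBoost_mulVec_velocity]
      rw [one_mul] at h2
      exact eq_neg_of_add_eq_zero_right h2
    have h4 := Matrix.mulVec_injective_of_isUnit ((Matrix.isUnit_iff_isUnit_det _).2 hbu) h3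
    have h5 := congrArg (m⁻¹ *ᵥ ·) h4
    simpa only [Matrix.mulVec_mulVec, Matrix.nonsing_inv_mul _ hmu', Matrix.one_mulVec,
      Matrix.mulVec_neg, Matrix.mulVec_smul] using h5
  let P : Params n := ⟨p, q, N, M, e, mbar, hN, hM, heu, hmu⟩
  have hPR : P.Rhat = R := P.Rhat_eq_of_posDef hR (by rw [P.boost_eq]; exact hχ)
  have hPm : P.m = m := by rw [Params.m, hPR]
  have hPg : P.g = g := by
    have : P.shiftG = ν := sub_add_cancel ν _
    rw [Params.g, this, hgN]
    rfl
  have hPf : P.f = f := by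
    have : P.shiftF = ν' := by
      rw [Params.shiftF, hPm]
      have : ν' = q + w := by rw [hw, add_sub_cancel]
      rw [this, hw', ← sub_eq_add_neg]
      rfl
    rw [Params.f, this, hfM]
    rfl
  refine ⟨P, rfl, rfl, hPg, hPf, ?_⟩
  have := P.isPrincipalSqrt_S
  rw [hPg, hPf] at this
  exact this.unique hS

end GeomMeanParam

end

theorem proposition1 (n : ℕ) :
    -- validity: arbitrary parameters produce a principal square root in the foliation
    (∀ P : GeomMeanParam.Params n,
      P.Rhat ∈ Matrix.orthogonalGroup (Fin n) ℝ ∧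
      GeomMeanParam.IsLorentzian P.g ∧ GeomMeanParam.SpacelikeSlice P.g ∧
      GeomMeanParam.IsLorentzian P.f ∧ GeomMeanParam.SpacelikeSlice P.f ∧
      GeomMeanParam.IsLorentzian P.h ∧ GeomMeanParam.SpacelikeSlice P.h ∧
      GeomMeanParam.IsPrincipalSqrt (P.g⁻¹ * P.f) P.S ∧
      P.S = P.h⁻¹ * P.f ∧
      P.h = GeomMeanParam.geomMean P.g P.f) ∧
    -- exhaustiveness: every principal square root in the foliation is produced,
    -- whichever spatial vielbeins represent the two spatial metrics
    (∀ g f S : GeomMeanParam.STMat n,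
      GeomMeanParam.IsLorentzian g → GeomMeanParam.SpacelikeSlice g →
      GeomMeanParam.IsLorentzian f → GeomMeanParam.SpacelikeSlice f →
      GeomMeanParam.IsPrincipalSqrt (g⁻¹ * f) S →
      (∃ P : GeomMeanParam.Params n, P.g = g ∧ P.f = f ∧ P.S = S) ∧
      (∀ e mbar : GeomMeanParam.SpMat n,
        eᵀ * e = g.toBlocks₂₂ → mbarᵀ * mbar = f.toBlocks₂₂ →
        ∃ P : GeomMeanParam.Params n,
          P.e = e ∧ P.mbar = mbar ∧ P.g = g ∧ P.f = f ∧ P.S = S)) := by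

  refine ⟨fun P => ⟨?_, P.isLorentzian_g, P.spacelikeSlice_g, P.isLorentzian_f,
    P.spacelikeSlice_f, P.isLorentzian_h, P.spacelikeSlice_h, P.isPrincipalSqrt_S, P.S_eq,
    P.h_eq_geomMean⟩, fun g f S hg hgs hf hfs hS => ⟨?_, fun e mbar he hm =>
    GeomMeanParam.exists_params hg hgs hf hfs hS he hm⟩⟩
  · rw [Matrix.mem_orthogonalGroup_iff']
    exact P.Rhat_transpose_mul_self
  · obtain ⟨e, he, hee⟩ := GeomMeanParam.exists_posDef_mul_self hgs
    obtain ⟨m, hm, hmm⟩ := GeomMeanParam.exists_posDef_mul_self hfs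
    obtain ⟨P, -, -, h⟩ := GeomMeanParam.exists_params hg hgs hf hfs hS
      (e := e) (mbar := m) (by rw [(GeomMeanParam.posDef_iff.1 he).1, hee])
      (by rw [(GeomMeanParam.posDef_iff.1 hm).1, hmm])
    exact ⟨P, h⟩
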